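/- All graphs are finite and simple, and a weighted graph $G_w$ is a graph $G$ together with a positive real weight on every edge. Its adjacency matrix has the weight of the edge $v_iv_j$ as its $(i,j)$ entry if $v_iv_j$ is an edge, and $0$ otherwise; $i_-(G_w)$ is the number of negative eigenvalues of this matrix, counted with multiplicity. A graph is bicyclic if it is connected and has exactly one more edge than vertices. A pendant is a vertex of degree one, and a pendant twin is a pair of distinct pendants with the same neighbour. For $p,l,q\ge 0$, at most one of them $0$, $\theta(p,l,q)$ is the graph formed by three paths, with $p+1$, $l+1$, $q+1$ edges, that have common end vertices $u,v$ and are otherwise disjoint. In a weighted graph built on $\theta(p,l,q)$, the weights of the successive edges from $u$ to $v$ are $a_1,\dots,a_{p+1}$ along the first path, $b_1,\dots,b_{l+1}$ along the second and $c_1,\dots,c_{q+1}$ along the third. **Theorem 4.6.** Let $G_w$ be a weighted bicyclic graph that has at least one pendant but no pendant twin. Then $i_-(G_w)=2$ if and only if $G_w$ is, up to isomorphism, one of the following: 1. with arbitrary weights: $\theta(1,1,1)$ with one pendant attached at $u$ ($G^1$); $\theta(1,1,1)$ with one pendant attached at $u$ and one at $v$ ($G^3$); $\theta(1,0,1)$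 with one pendant attached at $u$ ($G^6$); $\theta(1,0,1)$ with one pendant attached at $u$ and one at $v$ ($G^8$); 2. $\theta(1,1,1)$ with a path on two vertices attached by an edge from one of its ends, either to $u$ ($G^4$) or to the inner vertex of the third path ($G^5$), where $a_2b_1=a_1b_2$ and $a_2c_1=a_1c_2$; 3. $\theta(1,1,1)$ with one pendant attached to the inner vertex of the third path ($G^2$), where $a_1b_2=a_2b_1$; 4. $\theta(2,0,1)$ with one pendant attached to the inner vertex of the third path ($G^{11}$), where $a_1a_3=a_2b_1$. -/

import Mathlib

namespace WBicyclic

/-- A simple graph together with a positive real weight on each of its edges. -/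
structure WeightedGraph (V : Type*) where
  graph : SimpleGraph V
  weight : graph.edgeSet → ℝ
  weight_pos : ∀ e, 0 < weight e

namespace WeightedGraph

variable {V : Type*}

open Classical in
/-- The adjacency matrix: the entry at `(u, v)` is the weight of the edge `uv` if there is such an
edge, and `0` otherwise. -/
noncomputable def adjMatrix (G : WeightedGraph V) : Matrix V V ℝ :=
  Matrix.of fun u v => if h : G.graph.Adj u v then G.weight ⟨s(u, v), h⟩ else 0

theorem adjMatrix_isHermitian (G : WeightedGraph V) : G.adjMatrix.IsHermitian := by
  ext u v
  by_cases h : G.graph.Adj u v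
  · have h' := h.symm
    simp only [adjMatrix, Matrix.conjTranspose_apply, Matrix.of_apply, h, h', dif_pos, star_trivial]
    congr 1
    exact Subtype.ext Sym2.eq_swap
  · have h' : ¬ G.graph.Adj v u := fun k => h k.symm
    simp [adjMatrix, h, h']

open Classical in
/-- The negative index of inertia: the number of negative eigenvalues of the adjacency matrix,
counted with multiplicity. -/
noncomputable def negIndex [Fintype V] (G : WeightedGraph V) : ℕ :=
  (Finset.univ.filter fun i : V => G.adjMatrix_isHermitian.eigenvalues i < 0).card

/-- Connected, with exactly one more edge than vertices. -/
def IsBicyclic [Fintype V] (G : WeightedGraph V) : Prop :=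
  G.graph.Connected ∧ G.graph.edgeSet.ncard = Fintype.card V + 1

/-- A pendant vertex is a vertex with exactly one neighbour. -/
def IsPendant (G : WeightedGraph V) (v : V) : Prop :=
  (G.graph.neighborSet v).ncard = 1

/-- Two distinct pendant vertices with the same neighbourhood. -/
def IsPendantTwin (G : WeightedGraph V) (u v : V) : Prop :=
  u ≠ v ∧ G.IsPendant u ∧ G.IsPendant v ∧ G.graph.neighborSet u = G.graph.neighborSet v

end WeightedGraph

/-! The underlying graphs. In `G1`, …, `G5` the vertices `0, …, 4` span `θ(1,1,1)`: its vertices of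
degree three are `0` and `1`, and these are joined by the three paths `0-2-1`, `0-3-1`, `0-4-1`. -/

/-- `θ(1,1,1)` with one pendant vertex attached to a vertex of degree three. -/
def G1 : SimpleGraph (Fin 6) := SimpleGraph.fromEdgeSet
  {s(0, 2), s(2, 1), s(0, 3), s(3, 1), s(0, 4), s(4, 1), s(0, 5)}

/-- `θ(1,1,1)` with one pendant vertex attached to a vertex of degree two. -/
def G2 : SimpleGraph (Fin 6) := SimpleGraph.fromEdgeSet
  {s(0, 2), s(2, 1), s(0, 3), s(3, 1), s(0, 4), s(4, 1), s(4, 5)}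

/-- `θ(1,1,1)` with one pendant vertex attached to each of the two vertices of degree three. -/
def G3 : SimpleGraph (Fin 7) := SimpleGraph.fromEdgeSet
  {s(0, 2), s(2, 1), s(0, 3), s(3, 1), s(0, 4), s(4, 1), s(0, 5), s(1, 6)}

/-- `θ(1,1,1)` with a path on two vertices attached by one end to a vertex of degree three. -/
def G4 : SimpleGraph (Fin 7) := SimpleGraph.fromEdgeSet
  {s(0, 2), s(2, 1), s(0, 3), s(3, 1), s(0, 4), s(4, 1), s(0, 5), s(5, 6)}

/-- `θ(1,1,1)` with a path on two vertices attached by one end to a vertex of degree two. -/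
def G5 : SimpleGraph (Fin 7) := SimpleGraph.fromEdgeSet
  {s(0, 2), s(2, 1), s(0, 3), s(3, 1), s(0, 4), s(4, 1), s(4, 5), s(5, 6)}

/-- `θ(1,0,1)`, made of the paths `0-2-1`, `0-1`, `0-3-1`, with one pendant vertex attached to a
vertex of degree three. -/
def G6 : SimpleGraph (Fin 5) := SimpleGraph.fromEdgeSet
  {s(0, 2), s(2, 1), s(0, 1), s(0, 3), s(3, 1), s(0, 4)}

/-- `θ(1,0,1)`, made of the paths `0-2-1`, `0-1`, `0-3-1`, with one pendant vertex attached to each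
of the two vertices of degree three. -/
def G8 : SimpleGraph (Fin 6) := SimpleGraph.fromEdgeSet
  {s(0, 2), s(2, 1), s(0, 1), s(0, 3), s(3, 1), s(0, 4), s(1, 5)}

/-- `θ(2,0,1)`, made of the paths `0-2-3-1`, `0-1`, `0-4-1`, with one pendant vertex attached to
the vertex of degree two on its triangle. -/
def G11 : SimpleGraph (Fin 6) := SimpleGraph.fromEdgeSet
  {s(0, 2), s(2, 3), s(3, 1), s(0, 1), s(0, 4), s(4, 1), s(4, 5)}

namespace WeightedGraph

variable {V : Type*}

/-- The weights of `G`, read along an identification of the underlying graph with `H`. For an edge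
`ij` of `H` this is the weight of the corresponding edge of `G`. -/
noncomputable def wt (G : WeightedGraph V) {n : ℕ} {H : SimpleGraph (Fin n)} (φ : H ≃g G.graph)
    (i j : Fin n) : ℝ :=
  G.adjMatrix (φ i) (φ j)

/-- `G` is a weighted graph on `G2` such that, with `a₁, a₂` the weights along `0-2-1` and `b₁, b₂`
those along `0-3-1`, `a₁ b₂ = a₂ b₁`. -/
def IsG2 (G : WeightedGraph V) : Prop :=
  ∃ φ : G2 ≃g G.graph, G.wt φ 0 2 * G.wt φ 3 1 = G.wt φ 2 1 * G.wt φ 0 3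

/-- `G` is a weighted graph on `G4` such that, with `a₁, a₂`, `b₁, b₂` and `c₁, c₂` the weights
along `0-2-1`, `0-3-1` and `0-4-1`, `a₂ b₁ = a₁ b₂` and `a₂ c₁ = a₁ c₂`. -/
def IsG4 (G : WeightedGraph V) : Prop :=
  ∃ φ : G4 ≃g G.graph,
    G.wt φ 2 1 * G.wt φ 0 3 = G.wt φ 0 2 * G.wt φ 3 1 ∧
    G.wt φ 2 1 * G.wt φ 0 4 = G.wt φ 0 2 * G.wt φ 4 1

/-- The same two weight equalities, on `G5`. -/
def IsG5 (G : WeightedGraph V) : Prop :=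
  ∃ φ : G5 ≃g G.graph,
    G.wt φ 2 1 * G.wt φ 0 3 = G.wt φ 0 2 * G.wt φ 3 1 ∧
    G.wt φ 2 1 * G.wt φ 0 4 = G.wt φ 0 2 * G.wt φ 4 1

/-- `G` is a weighted graph on `G11` such that, with `a₁, a₂, a₃` the weights along `0-2-3-1` and
`b₁` the weight of the edge `0-1`, `a₁ a₃ = a₂ b₁`. -/
def IsG11 (G : WeightedGraph V) : Prop :=
  ∃ φ : G11 ≃g G.graph, G.wt φ 0 2 * G.wt φ 3 1 = G.wt φ 2 3 * G.wt φ 0 1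

end WeightedGraph

end WBicyclic

/-! A pendant edge `pq` spans a hyperbolic plane, so the negative index drops by at least one when
`p` and `q` are deleted (`succ_le_negIndex`). If the index is two, the remaining weighted graph
therefore has no two-dimensional negative definite subspace. This excludes triangles
(`not_triangle`) and nonzero bipartite 2×2 minors (`minor_eq_zero`). Since there are no pendant
twins, no remaining vertex is isolated, and the remainder must be complete bipartite with parts `R`,
`S` and a rank-one weight block (`exists_isPendantSplit`).

Let r, s be the part sizes and a, b the numbers of neighbours of `q` in each part. Counting edges
turns bicyclicity into (r - 1)(s - 1) + a + b = 3. Connectedness forces a + b ≥ 1, so the smaller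
part has one vertex or the sizes are 2, 2 or 2, 3. Each case gives listed graphs, and the vanishing
minors give their weight conditions.

Conversely, each listed adjacency matrix is a sum of two symmetrised rank-one products, each
contributing at most one negative eigenvalue. A pendant edge and an edge disjoint from it force at
least two (`negIndex_eq_two`). -/

namespace WBicyclic

open Matrix

/-! ### Negative eigenvalues and negative definite subspaces -/

section Inertia

variable {n : Type*} [Fintype n]

theorem exists_orthogonal_diagonalization [DecidableEq n] {A : Matrix n n ℝ}
    (hA : A.IsHermitian) : ∃ U : Matrix n n ℝ, Uᵀ * U = 1 ∧
      ∀ x : n → ℝ, x ⬝ᵥ A *ᵥ x = ∑ i, hA.eigenvalues i * (Uᵀ *ᵥ x) i ^ 2 := by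
  have h1 : (hA.eigenvectorUnitary : Matrix n n ℝ) * (hA.eigenvectorUnitary : Matrix n n ℝ)ᵀ = 1 := by
    have := Unitary.mul_star_self_of_mem hA.eigenvectorUnitary.2
    rwa [star_eq_conjTranspose, conjTranspose_eq_transpose_of_trivial] at this
  refine ⟨hA.eigenvectorUnitary, mul_eq_one_comm.mp h1, fun x => ?_⟩
  have h2 : A = (hA.eigenvectorUnitary : Matrix n n ℝ) * diagonal hA.eigenvalues *
      (hA.eigenvectorUnitary : Matrix n n ℝ)ᵀ := by
    conv_lhs => rw [hA.spectral_theorem, Unitary.conjStarAlgAut_apply]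
    rw [star_eq_conjTranspose, conjTranspose_eq_transpose_of_trivial]
    rfl
  generalize (hA.eigenvectorUnitary : Matrix n n ℝ) = U at *
  generalize hA.eigenvalues = l at *
  rw [h2, ← mulVec_mulVec, ← mulVec_mulVec, dotProduct_mulVec, ← mulVec_transpose]
  simp only [dotProduct, mulVec_diagonal]
  exact Finset.sum_congr rfl fun i _ => by ring

/-- A family of `d` vectors spanning a `d`-dimensional negative definite subspace bounds the number
of negative eigenvalues from below. -/
theorem le_card_neg_eigenvalues [DecidableEq n] {A : Matrix n n ℝ} (hA : A.IsHermitian) {d : ℕ}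
    (f : (Fin d → ℝ) →ₗ[ℝ] (n → ℝ)) (hf : ∀ s, s ≠ 0 → f s ⬝ᵥ A *ᵥ f s < 0) :
    d ≤ (Finset.univ.filter fun i => hA.eigenvalues i < 0).card := by
  obtain ⟨U, -, hU⟩ := exists_orthogonal_diagonalization hA
  by_contra! hlt
  let g : (n → ℝ) →ₗ[ℝ] ({i // hA.eigenvalues i < 0} → ℝ) :=
    (LinearMap.funLeft ℝ ℝ Subtype.val) ∘ₗ Uᵀ.mulVecLin
  -- With fewer negative eigenvalues than `d`, some nonzero `s` gives `f s` with no component along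
  -- negative eigenvectors, where the form is nonnegative.
  have hk : LinearMap.ker (g ∘ₗ f) ≠ ⊥ := by
    apply LinearMap.ker_ne_bot_of_finrank_lt
    rw [Module.finrank_fintype_fun_eq_card, Module.finrank_fintype_fun_eq_card,
      Fintype.card_subtype]
    simpa using hlt
  obtain ⟨s, hs, hs0⟩ := Submodule.exists_mem_ne_zero_of_ne_bot hk
  have := hf s hs0
  rw [hU] at this
  refine absurd this (not_lt.mpr (Finset.sum_nonneg fun i _ => ?_))
  by_cases hi : hA.eigenvalues i < 0
  · have h0 : (Uᵀ *ᵥ f s) i = 0 := congrFun (LinearMap.mem_ker.mp hs) ⟨i, hi⟩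
    simp [h0]
  · exact mul_nonneg (not_lt.mp hi) (sq_nonneg _)

/-- If the quadratic form is nonnegative on the common kernel of `k` linear functionals, then there
are at most `k` negative eigenvalues. -/
theorem card_neg_eigenvalues_le [DecidableEq n] {A : Matrix n n ℝ} (hA : A.IsHermitian) {k : ℕ}
    (L : (n → ℝ) →ₗ[ℝ] (Fin k → ℝ)) (hL : ∀ x, L x = 0 → 0 ≤ x ⬝ᵥ A *ᵥ x) :
    (Finset.univ.filter fun i => hA.eigenvalues i < 0).card ≤ k := by
  obtain ⟨U, hU', hU⟩ := exists_orthogonal_diagonalization hA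
  by_contra! hlt
  let e : ({i // hA.eigenvalues i < 0} → ℝ) →ₗ[ℝ] (n → ℝ) :=
    Function.ExtendByZero.linearMap ℝ Subtype.val
  -- With more than `k` negative eigenvalues, a nonzero combination of their eigenvectors is killed
  -- by `L`, although the form is negative there.
  have hk : LinearMap.ker (L ∘ₗ U.mulVecLin ∘ₗ e) ≠ ⊥ := by
    apply LinearMap.ker_ne_bot_of_finrank_lt
    rw [Module.finrank_fintype_fun_eq_card, Module.finrank_fintype_fun_eq_card,
      Fintype.card_subtype]
    simpa using hlt
  obtain ⟨c, hc, hc0⟩ := Submodule.exists_mem_ne_zero_of_ne_bot hk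
  have h0 := hL (U *ᵥ e c) (LinearMap.mem_ker.mp hc)
  rw [hU, mulVec_mulVec, hU', one_mulVec] at h0
  refine absurd h0 (not_le.mpr ?_)
  have hval : ∀ i : {i // hA.eigenvalues i < 0}, e c i = c i := fun i =>
    Subtype.val_injective.extend_apply _ _ _
  obtain ⟨i, hi⟩ := Function.ne_iff.mp hc0
  refine Finset.sum_neg' (fun j _ => ?_) ⟨i, Finset.mem_univ _, ?_⟩
  · by_cases hj : hA.eigenvalues j < 0
    · exact mul_nonpos_of_nonpos_of_nonneg hj.le (sq_nonneg _)
    · have : e c j = 0 := Function.extend_apply' _ _ _ (by rintro ⟨a, rfl⟩; exact hj a.2)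
      simp [this]
  · rw [hval]
    exact mul_neg_of_neg_of_pos i.2 (sq_pos_of_ne_zero hi)

end Inertia

/-! ### Bounds on the index and configurations forbidden away from a pendant edge -/

namespace WeightedGraph

variable {V : Type*} (G : WeightedGraph V)

theorem adjMatrix_comm (u v : V) : G.adjMatrix u v = G.adjMatrix v u :=
  (G.adjMatrix_isHermitian.apply v u)

theorem adjMatrix_pos {u v : V} : 0 < G.adjMatrix u v ↔ G.graph.Adj u v := by
  by_cases h : G.graph.Adj u v
  · simp [adjMatrix, h, G.weight_pos]
  · simp [adjMatrix, h]

theorem adjMatrix_eq_zero {u v : V} : G.adjMatrix u v = 0 ↔ ¬ G.graph.Adj u v := by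
  by_cases h : G.graph.Adj u v
  · simp [adjMatrix, h, (G.weight_pos _).ne']
  · simp [adjMatrix, h]

theorem adjMatrix_self (u : V) : G.adjMatrix u u = 0 := by simp [adjMatrix_eq_zero]

variable [Fintype V]

theorem le_negIndex {d : ℕ} (f : (Fin d → ℝ) →ₗ[ℝ] (V → ℝ))
    (hf : ∀ s, s ≠ 0 → f s ⬝ᵥ G.adjMatrix *ᵥ f s < 0) : d ≤ G.negIndex := by
  classical
  exact le_card_neg_eigenvalues _ f hf

/-- The form is 2(σ·x)(γ·x) + 2(α·x)(β·x). On the common kernel of σ - γ and α - β, which two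
functionals cut out, both products become squares. -/
theorem negIndex_le_two {σ γ α β : V → ℝ}
    (h : ∀ i j, G.adjMatrix i j = σ i * γ j + γ i * σ j + α i * β j + β i * α j) :
    G.negIndex ≤ 2 := by
  classical
  have hQ (x : V → ℝ) : x ⬝ᵥ G.adjMatrix *ᵥ x =
      2 * (σ ⬝ᵥ x) * (γ ⬝ᵥ x) + 2 * (α ⬝ᵥ x) * (β ⬝ᵥ x) := by
    have hA : G.adjMatrix = vecMulVec σ γ + vecMulVec γ σ + vecMulVec α β + vecMulVec β α := by
      ext i j; simp [vecMulVec_apply, h]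
    rw [hA, dotProduct_comm]
    simp only [add_mulVec, add_dotProduct, vecMulVec_mulVec, smul_dotProduct, op_smul_eq_smul,
      smul_eq_mul]
    ring
  refine card_neg_eigenvalues_le _ (k := 2) (Matrix.mulVecLin (of ![σ - γ, α - β])) fun x hx => ?_
  have h0 : σ ⬝ᵥ x = γ ⬝ᵥ x := by
    rw [← sub_eq_zero, ← sub_dotProduct]
    exact congrFun hx 0
  have h1 : α ⬝ᵥ x = β ⬝ᵥ x := by
    rw [← sub_eq_zero, ← sub_dotProduct]
    exact congrFun hx 1
  rw [hQ, h0, h1]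
  nlinarith [sq_nonneg (γ ⬝ᵥ x), sq_nonneg (β ⬝ᵥ x)]

/-- Deleting a pendant vertex together with its neighbour lowers the negative index by at least
one. -/
theorem succ_le_negIndex {p q : V} (hpq : G.graph.Adj p q) (hp : ∀ v, G.graph.Adj p v → v = q)
    {d : ℕ} (f : (Fin d → ℝ) →ₗ[ℝ] (V → ℝ)) (hfp : ∀ s, f s p = 0) (hfq : ∀ s, f s q = 0)
    (hf : ∀ s, s ≠ 0 → f s ⬝ᵥ G.adjMatrix *ᵥ f s < 0) : d + 1 ≤ G.negIndex := by
  classical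
  set A := G.adjMatrix with hA
  have hw : 0 < A p q := G.adjMatrix_pos.mpr hpq
  have hAp (y : V → ℝ) (hy : y q = 0) : (A *ᵥ y) p = 0 := by
    refine Finset.sum_eq_zero fun v _ => ?_
    by_cases hv : v = q
    · rw [hv, hy, mul_zero]
    · have : A p v = 0 := G.adjMatrix_eq_zero.mpr fun h => hv (hp v h)
      exact mul_eq_zero_of_left this _
  have hcol (y : V → ℝ) (v : V) : y ⬝ᵥ A.col v = (A *ᵥ y) v :=
    Finset.sum_congr rfl fun w _ => by rw [mul_comm, col_apply, hA, G.adjMatrix_comm w v]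
  -- In the coefficient of `p`, the term `-s 0` makes the plane of `p` and `q` contribute `-2 * A p
  -- q * s 0 ^ 2`. The quotient cancels the cross term between `q` and the image of `f`; `p` has no
  -- cross term because that image vanishes at `q`.
  let F : (Fin (d + 1) → ℝ) →ₗ[ℝ] (V → ℝ) :=
    { toFun := fun s => f (fun i => s i.succ) + s 0 • Pi.single q 1 +
        (-s 0 - (A *ᵥ f (fun i => s i.succ)) q / A p q) • Pi.single p 1
      map_add' := fun s t => by
        have : f (fun i : Fin d => (s + t) i.succ) =
          f (fun i => s i.succ) + f (fun i => t i.succ) := by rw [← map_add]; rfl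
        rw [this, mulVec_add]
        ext v
        simp only [Pi.add_apply, Pi.smul_apply, smul_eq_mul]
        ring
      map_smul' := fun r s => by
        have : f (fun i : Fin d => (r • s) i.succ) = r • f (fun i => s i.succ) := by
          rw [← map_smul]; rfl
        rw [this, mulVec_smul]
        ext v
        simp only [Pi.add_apply, Pi.smul_apply, smul_eq_mul, RingHom.id_apply]
        ring }
  have hF (s) : F s ⬝ᵥ A *ᵥ F s = f (fun i => s i.succ) ⬝ᵥ A *ᵥ f (fun i => s i.succ) -
      2 * A p q * s 0 ^ 2 := by
    change (f (fun i => s i.succ) + s 0 • Pi.single q 1 +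
        (-s 0 - (A *ᵥ f (fun i => s i.succ)) q / A p q) • Pi.single p 1) ⬝ᵥ A *ᵥ
        (f (fun i => s i.succ) + s 0 • Pi.single q 1 +
        (-s 0 - (A *ᵥ f (fun i => s i.succ)) q / A p q) • Pi.single p 1) = _
    have h1 := hfp fun i => s i.succ
    have h2 := hfq fun i => s i.succ
    generalize f (fun i => s i.succ) = y at *
    simp only [mulVec_add, dotProduct_add, add_dotProduct, mulVec_smul, dotProduct_smul,
      smul_dotProduct, smul_eq_mul, single_one_dotProduct, hcol, hAp y h2, mulVec_single_one, col_apply,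
      Pi.add_apply, Pi.smul_apply]
    rw [hA, G.adjMatrix_self, G.adjMatrix_self, G.adjMatrix_comm q p, ← hA]
    field_simp
    ring
  refine G.le_negIndex F fun s hs => ?_
  rw [← hA, hF]
  by_cases h : (fun i : Fin d => s i.succ) = 0
  · have h0 : s 0 ≠ 0 := fun h0 => hs <| funext <| Fin.cases h0 (congrFun h)
    rw [h, map_zero, zero_dotProduct]
    have := mul_pos hw (sq_pos_of_ne_zero h0)
    linarith
  · have := mul_nonneg hw.le (sq_nonneg (s 0))
    linarith [hf _ h]

theorem two_le_negIndex {p q : V} (hpq : G.graph.Adj p q) (hp : ∀ v, G.graph.Adj p v → v = q)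
    {i j : V} (hip : i ≠ p) (hiq : i ≠ q) (hjp : j ≠ p) (hjq : j ≠ q) (hij : G.graph.Adj i j) :
    2 ≤ G.negIndex := by
  classical
  -- The difference of the two end indicators of an edge is a negative vector.
  let f : (Fin 1 → ℝ) →ₗ[ℝ] (V → ℝ) :=
    { toFun := fun s => s 0 • (Pi.single i 1 - Pi.single j 1)
      map_add' := fun s t => by ext v; simp; ring
      map_smul' := fun r s => by ext v; simp; ring }
  refine G.succ_le_negIndex hpq hp f (fun s => by simp [f, hip.symm, hjp.symm])
    (fun s => by simp [f, hiq.symm, hjq.symm]) fun s hs => ?_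
  have h0 : s 0 ≠ 0 := fun h0 => hs <| funext fun k => by rw [Subsingleton.elim k 0, h0]; rfl
  have hQ : f s ⬝ᵥ G.adjMatrix *ᵥ f s = -2 * (G.adjMatrix i j * s 0 ^ 2) := by
    simp [f, mulVec_sub, dotProduct_sub, sub_dotProduct, mulVec_smul, adjMatrix_self,
      G.adjMatrix_comm j i]
    ring
  rw [hQ]
  have := mul_pos (G.adjMatrix_pos.mpr hij) (sq_pos_of_ne_zero h0)
  linarith

/-- If the negative index is two, no triangle avoids a pendant vertex and its neighbour. -/
theorem not_triangle {p q : V} (hpq : G.graph.Adj p q) (hp : ∀ v, G.graph.Adj p v → v = q)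
    (hneg : G.negIndex ≤ 2) {i j k : V} (hip : i ≠ p) (hiq : i ≠ q) (hjp : j ≠ p) (hjq : j ≠ q)
    (hkp : k ≠ p) (hkq : k ≠ q) (hij : G.graph.Adj i j) (hjk : G.graph.Adj j k)
    (hik : G.graph.Adj i k) : False := by
  classical
  set a := G.adjMatrix i j with ha
  set b := G.adjMatrix j k with hb
  set c := G.adjMatrix i k with hc
  -- Scaling each vertex by the weight of the opposite edge turns the form into 2abc(XY + YZ + ZX).
  -- On the plane X + Y + Z = 0 this is -abc(X² + Y² + Z²).
  let f : (Fin 2 → ℝ) →ₗ[ℝ] (V → ℝ) :=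
    { toFun := fun s => (s 0 * b) • Pi.single i 1 + ((s 1 - s 0) * c) • Pi.single j 1 -
        (s 1 * a) • Pi.single k 1
      map_add' := fun s t => by ext v; simp; ring
      map_smul' := fun r s => by ext v; simp; ring }
  refine absurd (G.succ_le_negIndex hpq hp f (fun s => by simp [f, hip.symm, hjp.symm, hkp.symm])
    (fun s => by simp [f, hiq.symm, hjq.symm, hkq.symm]) fun s hs => ?_) (by omega)
  have hQ : f s ⬝ᵥ G.adjMatrix *ᵥ f s = -(a * b * c * (s 0 ^ 2 + s 1 ^ 2 + (s 0 - s 1) ^ 2)) := by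
    simp [f, mulVec_add, mulVec_sub, dotProduct_sub, dotProduct_add, add_dotProduct,
      sub_dotProduct, mulVec_smul, adjMatrix_self, G.adjMatrix_comm j i, G.adjMatrix_comm k i,
      G.adjMatrix_comm k j, ← ha, ← hb, ← hc]
    ring
  have h0 : 0 < s 0 ^ 2 + s 1 ^ 2 := by
    by_contra! h
    refine hs (funext fun k => ?_)
    have h0 : s 0 = 0 := by nlinarith [sq_nonneg (s 0), sq_nonneg (s 1)]
    have h1 : s 1 = 0 := by nlinarith [sq_nonneg (s 0), sq_nonneg (s 1)]
    fin_cases k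
    exacts [h0, h1]
  have habc : 0 < a * b * c := mul_pos (mul_pos (G.adjMatrix_pos.mpr hij)
    (G.adjMatrix_pos.mpr hjk)) (G.adjMatrix_pos.mpr hik)
  rw [hQ, neg_lt_zero]
  have := sq_nonneg (s 0 - s 1)
  positivity

/-- If the negative index is two, then the bipartite `2 × 2` minors that avoid a pendant vertex and
its neighbour vanish. -/
theorem minor_eq_zero {p q : V} (hpq : G.graph.Adj p q) (hp : ∀ v, G.graph.Adj p v → v = q)
    (hneg : G.negIndex ≤ 2) {i i' j j' : V} (hip : i ≠ p) (hiq : i ≠ q) (hip' : i' ≠ p)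
    (hiq' : i' ≠ q) (hjp : j ≠ p) (hjq : j ≠ q) (hjp' : j' ≠ p) (hjq' : j' ≠ q)
    (hi : ¬ G.graph.Adj i i') (hj : ¬ G.graph.Adj j j') :
    G.adjMatrix i j * G.adjMatrix i' j' = G.adjMatrix i j' * G.adjMatrix i' j := by
  classical
  set a := G.adjMatrix i j with ha
  set b := G.adjMatrix i j' with hb
  set c := G.adjMatrix i' j with hc
  set d := G.adjMatrix i' j' with hd
  have hi0 := G.adjMatrix_eq_zero.mpr hi
  have hj0 := G.adjMatrix_eq_zero.mpr hj
  by_contra hne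
  have hD : a * d - b * c ≠ 0 := sub_ne_zero.mpr hne
  -- With B the 2×2 block, the form is 2uᵀBs. The choice u = -det(B) adj(B)ᵀs makes it -2
  -- det(B)²|s|² without any division.
  let f : (Fin 2 → ℝ) →ₗ[ℝ] (V → ℝ) :=
    { toFun := fun s => s 0 • Pi.single j 1 + s 1 • Pi.single j' 1 -
        ((a * d - b * c) * (s 0 * d - s 1 * c)) • Pi.single i 1 -
        ((a * d - b * c) * (s 1 * a - s 0 * b)) • Pi.single i' 1
      map_add' := fun s t => by ext v; simp; ring
      map_smul' := fun r s => by ext v; simp; ring }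
  refine absurd (G.succ_le_negIndex hpq hp f
    (fun s => by simp [f, hip.symm, hjp.symm, hip'.symm, hjp'.symm])
    (fun s => by simp [f, hiq.symm, hjq.symm, hiq'.symm, hjq'.symm]) fun s hs => ?_) (by omega)
  have hQ : f s ⬝ᵥ G.adjMatrix *ᵥ f s =
      -(2 * (a * d - b * c) ^ 2 * (s 0 ^ 2 + s 1 ^ 2)) := by
    simp [f, mulVec_add, mulVec_sub, dotProduct_sub, dotProduct_add, add_dotProduct,
      sub_dotProduct, mulVec_smul, adjMatrix_self, G.adjMatrix_comm j i, G.adjMatrix_comm j i',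
      G.adjMatrix_comm j' i, G.adjMatrix_comm j' i', G.adjMatrix_comm i' i, G.adjMatrix_comm j' j,
      ← ha, ← hb, ← hc, ← hd, hi0, hj0]
    ring
  have h0 : 0 < s 0 ^ 2 + s 1 ^ 2 := by
    by_contra! h
    refine hs (funext fun k => ?_)
    have h0 : s 0 = 0 := by nlinarith [sq_nonneg (s 0), sq_nonneg (s 1)]
    have h1 : s 1 = 0 := by nlinarith [sq_nonneg (s 0), sq_nonneg (s 1)]
    fin_cases k
    exacts [h0, h1]
  rw [hQ, neg_lt_zero]
  positivity

end WeightedGraph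
-- The listed graphs have negative index two
section Decidable

instance : DecidableRel G1.Adj :=
  inferInstanceAs (DecidableRel (SimpleGraph.fromEdgeSet _).Adj)

instance : DecidableRel G2.Adj :=
  inferInstanceAs (DecidableRel (SimpleGraph.fromEdgeSet _).Adj)

instance : DecidableRel G3.Adj :=
  inferInstanceAs (DecidableRel (SimpleGraph.fromEdgeSet _).Adj)

instance : DecidableRel G4.Adj :=
  inferInstanceAs (DecidableRel (SimpleGraph.fromEdgeSet _).Adj)

instance : DecidableRel G5.Adj :=
  inferInstanceAs (DecidableRel (SimpleGraph.fromEdgeSet _).Adj)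

instance : DecidableRel G6.Adj :=
  inferInstanceAs (DecidableRel (SimpleGraph.fromEdgeSet _).Adj)

instance : DecidableRel G8.Adj :=
  inferInstanceAs (DecidableRel (SimpleGraph.fromEdgeSet _).Adj)

instance : DecidableRel G11.Adj :=
  inferInstanceAs (DecidableRel (SimpleGraph.fromEdgeSet _).Adj)

end Decidable

namespace WeightedGraph

variable {V : Type*} (G : WeightedGraph V) {n : ℕ} {H : SimpleGraph (Fin n)} (φ : H ≃g G.graph)

theorem wt_comm (i j : Fin n) : G.wt φ i j = G.wt φ j i := G.adjMatrix_comm _ _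

theorem wt_pos {i j : Fin n} (h : H.Adj i j) : 0 < G.wt φ i j :=
  G.adjMatrix_pos.mpr (φ.map_adj_iff.mpr h)

theorem wt_eq_zero {i j : Fin n} (h : ¬ H.Adj i j) : G.wt φ i j = 0 :=
  G.adjMatrix_eq_zero.mpr fun h' => h (φ.map_adj_iff.mp h')

/-- The decomposition bounds the index above; the pendant edge `pq` and the disjoint edge `ij` bound
it below. By symmetry, the entries with `i ≤ j` suffice. -/
theorem negIndex_eq_two [Fintype V] {p q i j : Fin n} (hpq : H.Adj p q)
    (hp : ∀ v, H.Adj p v → v = q) (hne : i ≠ p ∧ i ≠ q ∧ j ≠ p ∧ j ≠ q) (hij : H.Adj i j)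
    {σ γ α β : Fin n → ℝ}
    (h : ∀ i j, i ≤ j → G.wt φ i j = σ i * γ j + γ i * σ j + α i * β j + β i * α j) :
    G.negIndex = 2 := by
  have inj {a b : Fin n} : φ a ≠ φ b ↔ a ≠ b := φ.injective.ne_iff
  refine le_antisymm (G.negIndex_le_two (σ := σ ∘ φ.symm) (γ := γ ∘ φ.symm) (α := α ∘ φ.symm)
    (β := β ∘ φ.symm) fun u v => ?_) (G.two_le_negIndex (p := φ p) (q := φ q) (i := φ i) (j := φ j)
    (φ.map_adj_iff.mpr hpq) (fun v hv => ?_) (inj.mpr hne.1) (inj.mpr hne.2.1)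
    (inj.mpr hne.2.2.1) (inj.mpr hne.2.2.2) (φ.map_adj_iff.mpr hij))
  · obtain ⟨i, rfl⟩ := φ.surjective u
    obtain ⟨j, rfl⟩ := φ.surjective v
    simp only [Function.comp_apply, RelIso.symm_apply_apply]
    rcases le_total i j with hle | hle
    · exact h i j hle
    · rw [G.adjMatrix_comm]
      exact (h j i hle).trans (by ring)
  · obtain ⟨j, rfl⟩ := φ.surjective v
    rw [hp j (φ.map_adj_iff.mp hv)]

variable [Fintype V]

/-- Vertices `0` and `1` cover all edges, so the matrix splits into two stars, each a symmetrised
product. The same holds for `G3`, `G6` and `G8`; when `0` and `1` are adjacent, their edge is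
counted in the star at `0`. -/
theorem negIndex_of_G1 (φ : G1 ≃g G.graph) : G.negIndex = 2 := by
  have h0 : ∀ i j, ¬ G1.Adj i j → G.wt φ i j = 0 := fun i j => G.wt_eq_zero φ
  refine G.negIndex_eq_two φ (p := 5) (q := 0) (i := 1) (j := 2) (by decide) (by decide)
    (by decide) (by decide)
    (σ := ![1, 0, 0, 0, 0, 0]) (γ := fun j => G.wt φ 0 j)
    (α := ![0, 1, 0, 0, 0, 0])
    (β := ![0, 0, G.wt φ 1 2, G.wt φ 1 3, G.wt φ 1 4, 0]) fun i j hij => ?_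
  fin_cases i <;> fin_cases j <;> first
    | exact absurd hij (by decide)
    | simp (disch := decide) [h0, G.wt_comm φ 0]

theorem negIndex_of_G3 (φ : G3 ≃g G.graph) : G.negIndex = 2 := by
  have h0 : ∀ i j, ¬ G3.Adj i j → G.wt φ i j = 0 := fun i j => G.wt_eq_zero φ
  refine G.negIndex_eq_two φ (p := 5) (q := 0) (i := 1) (j := 2) (by decide) (by decide)
    (by decide) (by decide)
    (σ := ![1, 0, 0, 0, 0, 0, 0]) (γ := fun j => G.wt φ 0 j)
    (α := ![0, 1, 0, 0, 0, 0, 0])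
    (β := ![0, 0, G.wt φ 1 2, G.wt φ 1 3, G.wt φ 1 4, 0, G.wt φ 1 6]) fun i j hij => ?_
  fin_cases i <;> fin_cases j <;> first
    | exact absurd hij (by decide)
    | simp (disch := decide) [h0, G.wt_comm φ 0]

theorem negIndex_of_G6 (φ : G6 ≃g G.graph) : G.negIndex = 2 := by
  have h0 : ∀ i j, ¬ G6.Adj i j → G.wt φ i j = 0 := fun i j => G.wt_eq_zero φ
  refine G.negIndex_eq_two φ (p := 4) (q := 0) (i := 1) (j := 2) (by decide) (by decide)
    (by decide) (by decide)
    (σ := ![1, 0, 0, 0, 0]) (γ := fun j => G.wt φ 0 j)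
    (α := ![0, 1, 0, 0, 0])
    (β := ![0, 0, G.wt φ 1 2, G.wt φ 1 3, 0]) fun i j hij => ?_
  fin_cases i <;> fin_cases j <;> first
    | exact absurd hij (by decide)
    | simp (disch := decide) [h0, G.wt_comm φ 0]

theorem negIndex_of_G8 (φ : G8 ≃g G.graph) : G.negIndex = 2 := by
  have h0 : ∀ i j, ¬ G8.Adj i j → G.wt φ i j = 0 := fun i j => G.wt_eq_zero φ
  refine G.negIndex_eq_two φ (p := 4) (q := 0) (i := 1) (j := 2) (by decide) (by decide)
    (by decide) (by decide)
    (σ := ![1, 0, 0, 0, 0, 0]) (γ := fun j => G.wt φ 0 j)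
    (α := ![0, 1, 0, 0, 0, 0])
    (β := ![0, 0, G.wt φ 1 2, G.wt φ 1 3, 0, G.wt φ 1 5]) fun i j hij => ?_
  fin_cases i <;> fin_cases j <;> first
    | exact absurd hij (by decide)
    | simp (disch := decide) [h0, G.wt_comm φ 0]

/-- One product is the star at the neighbour of the pendant. The rest is complete bipartite, and the
weight condition makes its block the rank-one product of `α` and `β`. The same scheme serves `G4`,
`G5` and `G11`. -/
theorem negIndex_of_G2 (φ : G2 ≃g G.graph)
    (h : G.wt φ 0 2 * G.wt φ 3 1 = G.wt φ 2 1 * G.wt φ 0 3) : G.negIndex = 2 := by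
  have h0 : ∀ i j, ¬ G2.Adj i j → G.wt φ i j = 0 := fun i j => G.wt_eq_zero φ
  have hw := (G.wt_pos φ (show G2.Adj 0 2 by decide)).ne'
  rw [G.wt_comm φ 3 1, G.wt_comm φ 2 1] at h
  refine G.negIndex_eq_two φ (p := 5) (q := 4) (i := 0) (j := 2) (by decide) (by decide)
    (by decide) (by decide)
    (σ := ![0, 0, 0, 0, 1, 0]) (γ := fun j => G.wt φ 4 j)
    (α := ![1, G.wt φ 1 2 / G.wt φ 0 2, 0, 0, 0, 0])
    (β := ![0, 0, G.wt φ 0 2, G.wt φ 0 3, 0, 0]) fun i j hij => ?_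
  fin_cases i <;> fin_cases j <;> first
    | exact absurd hij (by decide)
    | simp (disch := decide) [h0, G.wt_comm φ 4]
  all_goals field_simp <;> linarith

theorem negIndex_of_G4 (φ : G4 ≃g G.graph) (h : G.wt φ 2 1 * G.wt φ 0 3 = G.wt φ 0 2 * G.wt φ 3 1)
    (h' : G.wt φ 2 1 * G.wt φ 0 4 = G.wt φ 0 2 * G.wt φ 4 1) : G.negIndex = 2 := by
  have h0 : ∀ i j, ¬ G4.Adj i j → G.wt φ i j = 0 := fun i j => G.wt_eq_zero φ
  have hw := (G.wt_pos φ (show G4.Adj 0 2 by decide)).ne'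
  rw [G.wt_comm φ 3 1, G.wt_comm φ 2 1] at h
  rw [G.wt_comm φ 4 1, G.wt_comm φ 2 1] at h'
  refine G.negIndex_eq_two φ (p := 6) (q := 5) (i := 0) (j := 2) (by decide) (by decide)
    (by decide) (by decide)
    (σ := ![0, 0, 0, 0, 0, 1, 0]) (γ := fun j => G.wt φ 5 j)
    (α := ![1, G.wt φ 1 2 / G.wt φ 0 2, 0, 0, 0, 0, 0])
    (β := ![0, 0, G.wt φ 0 2, G.wt φ 0 3, G.wt φ 0 4, 0, 0]) fun i j hij => ?_
  fin_cases i <;> fin_cases j <;> first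
    | exact absurd hij (by decide)
    | simp (disch := decide) [h0, G.wt_comm φ 5]
  all_goals field_simp <;> linarith

theorem negIndex_of_G5 (φ : G5 ≃g G.graph) (h : G.wt φ 2 1 * G.wt φ 0 3 = G.wt φ 0 2 * G.wt φ 3 1)
    (h' : G.wt φ 2 1 * G.wt φ 0 4 = G.wt φ 0 2 * G.wt φ 4 1) : G.negIndex = 2 := by
  have h0 : ∀ i j, ¬ G5.Adj i j → G.wt φ i j = 0 := fun i j => G.wt_eq_zero φ
  have hw := (G.wt_pos φ (show G5.Adj 0 2 by decide)).ne'
  rw [G.wt_comm φ 3 1, G.wt_comm φ 2 1] at h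
  rw [G.wt_comm φ 4 1, G.wt_comm φ 2 1] at h'
  refine G.negIndex_eq_two φ (p := 6) (q := 5) (i := 0) (j := 2) (by decide) (by decide)
    (by decide) (by decide)
    (σ := ![0, 0, 0, 0, 0, 1, 0]) (γ := fun j => G.wt φ 5 j)
    (α := ![1, G.wt φ 1 2 / G.wt φ 0 2, 0, 0, 0, 0, 0])
    (β := ![0, 0, G.wt φ 0 2, G.wt φ 0 3, G.wt φ 0 4, 0, 0]) fun i j hij => ?_
  fin_cases i <;> fin_cases j <;> first
    | exact absurd hij (by decide)
    | simp (disch := decide) [h0, G.wt_comm φ 5]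
  all_goals field_simp <;> linarith

theorem negIndex_of_G11 (φ : G11 ≃g G.graph)
    (h : G.wt φ 0 2 * G.wt φ 3 1 = G.wt φ 2 3 * G.wt φ 0 1) : G.negIndex = 2 := by
  have h0 : ∀ i j, ¬ G11.Adj i j → G.wt φ i j = 0 := fun i j => G.wt_eq_zero φ
  have hw := (G.wt_pos φ (show G11.Adj 0 1 by decide)).ne'
  rw [G.wt_comm φ 3 1] at h
  refine G.negIndex_eq_two φ (p := 5) (q := 4) (i := 0) (j := 1) (by decide) (by decide)
    (by decide) (by decide)
    (σ := ![0, 0, 0, 0, 1, 0]) (γ := fun j => G.wt φ 4 j)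
    (α := ![1, 0, 0, G.wt φ 1 3 / G.wt φ 0 1, 0, 0])
    (β := ![0, G.wt φ 0 1, G.wt φ 0 2, 0, 0, 0]) fun i j hij => ?_
  fin_cases i <;> fin_cases j <;> first
    | exact absurd hij (by decide)
    | simp (disch := decide) [h0, G.wt_comm φ 4]
  all_goals field_simp <;> linarith

end WeightedGraph
-- A bijection on vertices mapping edges to edges is an isomorphism as soon as the target has no
-- more edges than the source.
theorem exists_iso_of_card {V : Type*} [Fintype V] {n : ℕ} {s : Set (Sym2 (Fin n))}
    [DecidableRel (SimpleGraph.fromEdgeSet s).Adj] {K : SimpleGraph V} {f : Fin n → V}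
    (hf : (List.ofFn f).Nodup) (hn : Fintype.card V = n)
    (hs : ∀ e ∈ s, e.map f ∈ K.edgeSet)
    (hK : K.edgeSet.ncard ≤ (SimpleGraph.fromEdgeSet s).edgeFinset.card) :
    ∃ φ : SimpleGraph.fromEdgeSet s ≃g K, ∀ i, φ i = f i := by
  replace hf : Function.Injective f := List.nodup_ofFn.mp hf
  have hbij : Function.Bijective f :=
    (Fintype.bijective_iff_injective_and_card f).mpr ⟨hf, by rw [hn, Fintype.card_fin]⟩
  have hsub : Sym2.map f '' (SimpleGraph.fromEdgeSet s).edgeSet ⊆ K.edgeSet := by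
    rintro _ ⟨e, he, rfl⟩
    rw [SimpleGraph.edgeSet_fromEdgeSet] at he
    exact hs e he.1
  have heq := Set.eq_of_subset_of_ncard_le hsub (by
    rw [Set.ncard_image_of_injective _ (Sym2.map.injective hf)]
    rwa [← (SimpleGraph.fromEdgeSet s).coe_edgeFinset, Set.ncard_coe_finset]) (Set.toFinite _)
  refine ⟨⟨Equiv.ofBijective f hbij, @fun i j => ⟨fun h => ?_, fun h => ?_⟩⟩, fun i => rfl⟩
  · have h' : s(f i, f j) ∈ K.edgeSet := h
    rw [← heq] at h'
    obtain ⟨e, he, hef⟩ := h'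
    rw [← Sym2.map_mk, (Sym2.map.injective hf).eq_iff] at hef
    rwa [hef] at he
  · exact hsub ⟨s(i, j), h, rfl⟩

/-! ### Structure left after removing a pendant edge -/

namespace WeightedGraph

variable {V : Type*} (G : WeightedGraph V)

/-- `p` is a pendant vertex at `q`, and the other vertices induce a complete bipartite graph with
parts `R` and `S`, whose matrix of weights has rank at most one. -/
structure IsPendantSplit (p q : V) (R S : Finset V) : Prop where
  adj : G.graph.Adj p q
  pendant : ∀ v, G.graph.Adj p v → v = q
  cover : ∀ v, v = p ∨ v = q ∨ v ∈ R ∨ v ∈ S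
  left_ne : ∀ v ∈ R, v ≠ p ∧ v ≠ q
  right_ne : ∀ v ∈ S, v ≠ p ∧ v ≠ q
  disjoint : Disjoint R S
  left_indep : ∀ i ∈ R, ∀ j ∈ R, ¬ G.graph.Adj i j
  right_indep : ∀ i ∈ S, ∀ j ∈ S, ¬ G.graph.Adj i j
  complete : ∀ i ∈ R, ∀ j ∈ S, G.graph.Adj i j
  minor : ∀ i ∈ R, ∀ i' ∈ R, ∀ j ∈ S, ∀ j' ∈ S,
    G.adjMatrix i j * G.adjMatrix i' j' = G.adjMatrix i j' * G.adjMatrix i' j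

variable {G} {p q : V} {R S : Finset V}

theorem IsPendantSplit.symm (h : G.IsPendantSplit p q R S) : G.IsPendantSplit p q S R where
  adj := h.adj
  pendant := h.pendant
  cover v := by have := h.cover v; tauto
  left_ne := h.right_ne
  right_ne := h.left_ne
  disjoint := h.disjoint.symm
  left_indep := h.right_indep
  right_indep := h.left_indep
  complete i hi j hj := (h.complete j hj i hi).symm
  minor i hi i' hi' j hj j' hj' := by
    rw [G.adjMatrix_comm i, G.adjMatrix_comm i', G.adjMatrix_comm i, G.adjMatrix_comm i']
    rw [h.minor j hj j' hj' i hi i' hi', mul_comm]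

theorem IsPendantSplit.notMem (h : G.IsPendantSplit p q R S) :
    p ∉ R ∧ p ∉ S ∧ q ∉ R ∧ q ∉ S :=
  ⟨fun k => (h.left_ne p k).1 rfl, fun k => (h.right_ne p k).1 rfl,
    fun k => (h.left_ne q k).2 rfl, fun k => (h.right_ne q k).2 rfl⟩

variable [Fintype V]

open Classical in
theorem IsPendantSplit.univ_eq (h : G.IsPendantSplit p q R S) :
    (Finset.univ : Finset V) = insert p (insert q (R ∪ S)) := by
  ext v
  simpa using h.cover v

theorem IsPendantSplit.card_eq (h : G.IsPendantSplit p q R S) :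
    Fintype.card V = R.card + S.card + 2 := by
  classical
  obtain ⟨hpR, hpS, hqR, hqS⟩ := h.notMem
  rw [← Finset.card_univ, h.univ_eq, Finset.card_insert_of_notMem (by simp [*, h.adj.ne]),
    Finset.card_insert_of_notMem (by simp [*]), Finset.card_union_of_disjoint h.disjoint]

open Classical in
theorem IsPendantSplit.degree_left (h : G.IsPendantSplit p q R S) {i : V} (hi : i ∈ R) :
    G.graph.degree i = S.card + if G.graph.Adj q i then 1 else 0 := by
  obtain ⟨hpR, hpS, hqR, hqS⟩ := h.notMem
  have : G.graph.neighborFinset i = S ∪ (if G.graph.Adj q i then {q} else ∅) := by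
    ext v
    rw [SimpleGraph.mem_neighborFinset, Finset.mem_union]
    constructor
    · intro hv
      rcases h.cover v with rfl | rfl | hR | hS
      · exact absurd (h.pendant i hv.symm) (h.left_ne i hi).2
      · simp [hv.symm]
      · exact absurd hv (h.left_indep i hi v hR)
      · exact Or.inl hS
    · rintro (hS | hv)
      · exact h.complete i hi v hS
      · split_ifs at hv with hq
        · rw [Finset.mem_singleton.mp hv]; exact hq.symm
        · simp at hv
  rw [← SimpleGraph.card_neighborFinset_eq_degree, this, Finset.card_union_of_disjoint]
  · split_ifs <;> simp
  · split_ifs <;> simp [hqS]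

open Classical in
theorem IsPendantSplit.ncard_edgeSet (h : G.IsPendantSplit p q R S) :
    G.graph.edgeSet.ncard = R.card * S.card + 1 + (R.filter fun i => G.graph.Adj q i).card +
      (S.filter fun i => G.graph.Adj q i).card := by
  obtain ⟨hpR, hpS, hqR, hqS⟩ := h.notMem
  have hdp : G.graph.degree p = 1 := by
    rw [← SimpleGraph.card_neighborFinset_eq_degree, Finset.card_eq_one]
    refine ⟨q, ?_⟩
    ext v
    rw [SimpleGraph.mem_neighborFinset, Finset.mem_singleton]
    exact ⟨h.pendant v, fun hv => hv ▸ h.adj⟩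
  have hdq : G.graph.degree q = 1 + (R.filter fun i => G.graph.Adj q i).card +
      (S.filter fun i => G.graph.Adj q i).card := by
    have : G.graph.neighborFinset q = insert p ((R.filter fun i => G.graph.Adj q i) ∪
        (S.filter fun i => G.graph.Adj q i)) := by
      ext v
      simp only [SimpleGraph.mem_neighborFinset, Finset.mem_insert, Finset.mem_union,
        Finset.mem_filter]
      constructor
      · intro hv
        rcases h.cover v with rfl | rfl | hR | hS
        · exact Or.inl rfl
        · exact absurd rfl hv.ne
        · exact Or.inr (Or.inl ⟨hR, hv⟩)
        · exact Or.inr (Or.inr ⟨hS, hv⟩)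
      · rintro (rfl | hv | hv)
        exacts [h.adj.symm, hv.2, hv.2]
    rw [← SimpleGraph.card_neighborFinset_eq_degree, this,
      Finset.card_insert_of_notMem (by simp [hpR, hpS]), Finset.card_union_of_disjoint
      (Finset.disjoint_filter_filter h.disjoint)]
    ring
  have hsum := G.graph.sum_degrees_eq_twice_card_edges
  rw [h.univ_eq, Finset.sum_insert (by simp [*, h.adj.ne]), Finset.sum_insert (by simp [*]),
    Finset.sum_union h.disjoint, Finset.sum_congr rfl fun i hi => h.degree_left hi,
    Finset.sum_congr (s₁ := S) rfl fun i hi => h.symm.degree_left hi, hdp, hdq,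
    Finset.sum_add_distrib, Finset.sum_add_distrib, ← Finset.card_filter, ← Finset.card_filter,
    Finset.sum_const, Finset.sum_const, smul_eq_mul, smul_eq_mul, mul_comm S.card] at hsum
  rw [← SimpleGraph.coe_edgeFinset, Set.ncard_coe_finset]
  omega

theorem exists_isPendantSplit (hbi : G.IsBicyclic) (hpend : ∃ v : V, G.IsPendant v)
    (htwin : ¬ ∃ u v : V, G.IsPendantTwin u v) (hneg : G.negIndex ≤ 2) :
    ∃ p q R S, G.IsPendantSplit p q R S := by
  classical
  obtain ⟨hconn, hcard⟩ := hbi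
  obtain ⟨p, hp1⟩ := hpend
  obtain ⟨q, hq⟩ := Set.ncard_eq_one.mp hp1
  have hpq : G.graph.Adj p q := by
    rw [← SimpleGraph.mem_neighborSet, hq]; rfl
  have hp : ∀ v, G.graph.Adj p v → v = q := fun v hv => by
    rwa [← SimpleGraph.mem_neighborSet, hq] at hv
  -- A vertex isolated by the deletion would be a second pendant at `q`, a twin of `p`.
  have hiso : ∀ v, v ≠ p → v ≠ q → ∃ w, w ≠ p ∧ w ≠ q ∧ G.graph.Adj v w := by
    intro v hvp hvq
    by_contra! hno
    have hsub : ∀ w, G.graph.Adj v w → w = q := fun w hw => by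
      by_contra hwq
      exact hno w (fun hwp => hvq (hp v (hwp ▸ hw.symm))) hwq hw
    have : Nontrivial V := ⟨v, p, hvp⟩
    obtain ⟨w, hw⟩ := hconn.preconnected.exists_adj_of_nontrivial v
    obtain rfl := hsub w hw
    have hnv : G.graph.neighborSet v = {w} := by
      ext x
      exact ⟨hsub x, fun hx => (show x = w from hx) ▸ hw⟩
    exact htwin ⟨v, p, hvp, by rw [IsPendant, hnv, Set.ncard_singleton], hp1, by rw [hnv, hq]⟩
  have hex : ∃ v, v ≠ p ∧ v ≠ q := by
    by_contra! hall
    have h2 : Fintype.card V ≤ 2 := by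
      rw [← Finset.card_univ]
      refine (Finset.card_le_card (t := {p, q}) fun v _ => ?_).trans Finset.card_le_two
      have := hall v
      simp only [Finset.mem_insert, Finset.mem_singleton]
      tauto
    have hle := G.graph.card_edgeFinset_le_card_choose_two
    rw [← Set.ncard_coe_finset, SimpleGraph.coe_edgeFinset, hcard] at hle
    have h1 : 0 < Fintype.card V := Fintype.card_pos_iff.mpr ⟨p⟩
    have := Nat.choose_le_choose 2 h2
    rw [Nat.choose_self] at this
    omega
  obtain ⟨i₀, hi₀p, hi₀q⟩ := hex
  obtain ⟨j₀, hj₀p, hj₀q, hadj⟩ := hiso i₀ hi₀p hi₀q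
  have htri := @G.not_triangle _ _ _ _ hpq hp hneg
  have hmin := @G.minor_eq_zero _ _ _ _ hpq hp hneg
  have hpos {u v : V} (h : G.graph.Adj u v) := (G.adjMatrix_pos.mpr h).ne'
  -- The parts are the remaining neighbourhoods of the two ends of one fixed edge `i₀j₀`.
  have hR : ∀ i, i ∈ Finset.univ.filter (fun v => v ≠ p ∧ v ≠ q ∧ G.graph.Adj v j₀) ↔
    i ≠ p ∧ i ≠ q ∧ G.graph.Adj i j₀ := by simp
  have hS : ∀ i, i ∈ Finset.univ.filter (fun v => v ≠ p ∧ v ≠ q ∧ G.graph.Adj i₀ v) ↔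
    i ≠ p ∧ i ≠ q ∧ G.graph.Adj i₀ i := by simp
  generalize Finset.univ.filter (fun v => v ≠ p ∧ v ≠ q ∧ G.graph.Adj v j₀) = R at hR
  generalize Finset.univ.filter (fun v => v ≠ p ∧ v ≠ q ∧ G.graph.Adj i₀ v) = S at hS
  have hRi : ∀ i ∈ R, ∀ j ∈ R, ¬ G.graph.Adj i j := fun i hi j hj h => by
    rw [hR] at hi hj
    exact htri hi.1 hi.2.1 hj.1 hj.2.1 hj₀p hj₀q h hj.2.2 hi.2.2
  have hSi : ∀ i ∈ S, ∀ j ∈ S, ¬ G.graph.Adj i j := fun i hi j hj h => by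
    rw [hS] at hi hj
    exact htri hi₀p hi₀q hi.1 hi.2.1 hj.1 hj.2.1 hi.2.2 h hj.2.2
  have hm : ∀ i ∈ R, ∀ i' ∈ R, ∀ j ∈ S, ∀ j' ∈ S,
      G.adjMatrix i j * G.adjMatrix i' j' = G.adjMatrix i j' * G.adjMatrix i' j := by
    intro i hi i' hi' j hj j' hj'
    have h1 := hRi i hi i' hi'
    have h2 := hSi j hj j' hj'
    rw [hR] at hi hi'
    rw [hS] at hj hj'
    exact hmin hi.1 hi.2.1 hi'.1 hi'.2.1 hj.1 hj.2.1 hj'.1 hj'.2.1 h1 h2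
  have hi₀R : i₀ ∈ R := (hR _).mpr ⟨hi₀p, hi₀q, hadj⟩
  have hj₀S : j₀ ∈ S := (hS _).mpr ⟨hj₀p, hj₀q, hadj⟩
  refine ⟨p, q, R, S, hpq, hp, fun k => ?_, fun v hv => ⟨((hR v).mp hv).1, ((hR v).mp hv).2.1⟩,
    fun v hv => ⟨((hS v).mp hv).1, ((hS v).mp hv).2.1⟩, ?_, hRi, hSi, fun i hi j hj => ?_, hm⟩
  -- A vertex `k` outside both parts has an edge `kl`. Whether or not `l` is adjacent to `i₀`, a
  -- minor equates the product of the weights of `i₀j₀` and `kl` with zero.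
  · by_contra! hk
    obtain ⟨hkp, hkq, hkR, hkS⟩ := hk
    have h1 : ¬ G.graph.Adj k j₀ := fun h => hkR ((hR k).mpr ⟨hkp, hkq, h⟩)
    have h2 : ¬ G.graph.Adj i₀ k := fun h => hkS ((hS k).mpr ⟨hkp, hkq, h⟩)
    obtain ⟨l, hlp, hlq, hkl⟩ := hiso k hkp hkq
    by_cases h3 : G.graph.Adj i₀ l
    · have h4 : ¬ G.graph.Adj j₀ l := fun h => htri hi₀p hi₀q hj₀p hj₀q hlp hlq hadj h h3
      have := hmin hi₀p hi₀q hkp hkq hj₀p hj₀q hlp hlq h2 h4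
      rw [G.adjMatrix_eq_zero.mpr h1, mul_zero] at this
      exact mul_ne_zero (hpos hadj) (hpos hkl) this
    · have := hmin hi₀p hi₀q hlp hlq hj₀p hj₀q hkp hkq h3 fun h => h1 h.symm
      rw [G.adjMatrix_eq_zero.mpr h2, zero_mul] at this
      exact mul_ne_zero (hpos hadj) (hpos hkl.symm) this
  · rw [Finset.disjoint_left]
    intro v hvR hvS
    exact hRi v hvR i₀ hi₀R ((hS v).mp hvS).2.2.symm
  -- The minor equates the product of the weights of `ij` and `i₀j₀` with that of `ij₀` and `i₀j`,
  -- which is positive.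
  · have := hm i hi i₀ hi₀R j hj j₀ hj₀S
    rw [← G.adjMatrix_pos]
    have h1 := mul_pos (G.adjMatrix_pos.mpr ((hR i).mp hi).2.2)
      (G.adjMatrix_pos.mpr ((hS j).mp hj).2.2)
    rw [← this] at h1
    exact pos_of_mul_pos_left h1 (G.adjMatrix_pos.mpr hadj).le


/-- The graphs with a negative index of inertia equal to two. -/
def IsExceptional (G : WeightedGraph V) : Prop :=
  Nonempty (G1 ≃g G.graph) ∨ Nonempty (G3 ≃g G.graph) ∨ Nonempty (G6 ≃g G.graph) ∨
    Nonempty (G8 ≃g G.graph) ∨ G.IsG4 ∨ G.IsG5 ∨ G.IsG2 ∨ G.IsG11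

/-! ### Classification by part sizes -/

open Classical in
-- Here `q` and the centre `c` are the branch vertices. They have three common neighbours, or two if
-- adjacent. Every other vertex of `S` is a pendant at `c`, so there is at most one.
theorem IsPendantSplit.isExceptional_of_star (h : G.IsPendantSplit p q R S) (hbi : G.IsBicyclic)
    (htwin : ¬ ∃ u v : V, G.IsPendantTwin u v) (hR : R.card = 1) : G.IsExceptional := by
  have hE := h.ncard_edgeSet
  have hV := h.card_eq
  have hG := hbi.2.le
  rw [hbi.2, hV, hR] at hE
  have hqp := h.adj.symm
  have hne := h.adj.ne
  obtain ⟨c, rfl⟩ := Finset.card_eq_one.mp hR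
  have hc := h.left_ne c (Finset.mem_singleton_self c)
  have hcS : ∀ v ∈ S, G.graph.Adj c v := h.complete c (Finset.mem_singleton_self c)
  have hd : ∀ v ∈ S, v ≠ p ∧ v ≠ q ∧ v ≠ c := fun v hv =>
    ⟨(h.right_ne v hv).1, (h.right_ne v hv).2, (hcS v hv).ne'⟩
  have hsplit := S.card_filter_add_card_filter_not (fun i => G.graph.Adj q i)
  have hN : ∀ v ∈ S.filter (fun i => G.graph.Adj q i), G.graph.Adj q v ∧ G.graph.Adj c v ∧
      v ≠ p ∧ v ≠ q ∧ v ≠ c := fun v hv => by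
    rw [Finset.mem_filter] at hv
    exact ⟨hv.2, hcS v hv.1, hd v hv.1⟩
  have hM : ∀ v ∈ S.filter (fun i => ¬ G.graph.Adj q i), ¬ G.graph.Adj q v ∧ G.graph.Adj c v ∧
      v ≠ p ∧ v ≠ q ∧ v ≠ c := fun v hv => by
    rw [Finset.mem_filter] at hv
    exact ⟨hv.2, hcS v hv.1, hd v hv.1⟩
  have hM1 : (S.filter (fun i => ¬ G.graph.Adj q i)).card ≤ 1 := by
    have hnb : ∀ v ∈ S.filter (fun i => ¬ G.graph.Adj q i), G.graph.neighborSet v = {c} := by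
      intro v hv
      rw [Finset.mem_filter] at hv
      obtain ⟨hvS, hvq⟩ := hv
      ext x
      refine ⟨fun hx => ?_, fun hx => (show x = c from hx) ▸ (hcS v hvS).symm⟩
      rcases h.cover x with rfl | rfl | hx' | hx'
      · exact absurd (h.pendant v hx.symm) (h.right_ne v hvS).2
      · exact absurd hx.symm hvq
      · exact Finset.mem_singleton.mp hx'
      · exact absurd hx (h.right_indep v hvS x hx')
    rw [Finset.card_le_one]
    intro u hu v hv
    by_contra hne
    exact htwin ⟨u, v, hne, by rw [IsPendant, hnb u hu, Set.ncard_singleton],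
      by rw [IsPendant, hnb v hv, Set.ncard_singleton], by rw [hnb u hu, hnb v hv]⟩
  rw [hR] at hV
  clear h hbi htwin hR hcS hd
  generalize S.filter (fun i => G.graph.Adj q i) = N at *
  generalize S.filter (fun i => ¬ G.graph.Adj q i) = M at *
  by_cases hqc : G.graph.Adj q c
  · rw [Finset.filter_singleton, if_pos hqc, Finset.card_singleton] at hE
    obtain ⟨x, y, hxy, rfl⟩ := Finset.card_eq_two.mp (show N.card = 2 by omega)
    rw [Finset.card_pair hxy] at hsplit
    obtain ⟨hqx, hcx, hx⟩ := hN x (by simp)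
    obtain ⟨hqy, hcy, hy⟩ := hN y (by simp)
    clear hN
    rcases Nat.le_one_iff_eq_zero_or_eq_one.mp hM1 with hM0 | hM1
    · have hn : Fintype.card V = 5 := by omega
      clear hM hM1 hM0 hsplit hE hV
      obtain ⟨φ, hφ⟩ := exists_iso_of_card (K := G.graph) (f := ![q, c, x, y, p])
        (s := {s(0, 2), s(2, 1), s(0, 1), s(0, 3), s(3, 1), s(0, 4)})
        (by simp only [List.ofFn_succ, List.nodup_cons]; simp; grind [SimpleGraph.irrefl]) hn
        (by
          simp only [Set.mem_insert_iff, Set.mem_singleton_iff, forall_eq_or_imp, forall_eq,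
            Sym2.map_mk, SimpleGraph.mem_edgeSet]
          exact ⟨hqx, hcx.symm, hqc, hqy, hcy.symm, hqp⟩)
        (hG.trans (by rw [hn]; decide))
      exact Or.inr (Or.inr (Or.inl ⟨φ⟩))
    · obtain ⟨t, rfl⟩ := Finset.card_eq_one.mp hM1
      obtain ⟨hqt, hct, ht⟩ := hM t (by simp)
      have hn : Fintype.card V = 6 := by omega
      clear hM hM1 hsplit hE hV
      obtain ⟨φ, hφ⟩ := exists_iso_of_card (K := G.graph) (f := ![q, c, x, y, p, t])
        (s := {s(0, 2), s(2, 1), s(0, 1), s(0, 3), s(3, 1), s(0, 4), s(1, 5)})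
        (by simp only [List.ofFn_succ, List.nodup_cons]; simp; grind [SimpleGraph.irrefl]) hn
        (by
          simp only [Set.mem_insert_iff, Set.mem_singleton_iff, forall_eq_or_imp, forall_eq,
            Sym2.map_mk, SimpleGraph.mem_edgeSet]
          exact ⟨hqx, hcx.symm, hqc, hqy, hcy.symm, hqp, hct⟩)
        (hG.trans (by rw [hn]; decide))
      exact Or.inr (Or.inr (Or.inr (Or.inl ⟨φ⟩)))
  · rw [Finset.filter_singleton, if_neg hqc, Finset.card_empty] at hE
    obtain ⟨x, y, z, hxy, hxz, hyz, rfl⟩ := Finset.card_eq_three.mp (show N.card = 3 by omega)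
    rw [Finset.card_eq_three.mpr ⟨x, y, z, hxy, hxz, hyz, rfl⟩] at hsplit
    obtain ⟨hqx, hcx, hx⟩ := hN x (by simp)
    obtain ⟨hqy, hcy, hy⟩ := hN y (by simp)
    obtain ⟨hqz, hcz, hz⟩ := hN z (by simp)
    clear hN
    rcases Nat.le_one_iff_eq_zero_or_eq_one.mp hM1 with hM0 | hM1
    · have hn : Fintype.card V = 6 := by omega
      clear hM hM1 hM0 hsplit hE hV
      obtain ⟨φ, hφ⟩ := exists_iso_of_card (K := G.graph) (f := ![q, c, x, y, z, p])
        (s := {s(0, 2), s(2, 1), s(0, 3), s(3, 1), s(0, 4), s(4, 1), s(0, 5)})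
        (by simp only [List.ofFn_succ, List.nodup_cons]; simp; grind [SimpleGraph.irrefl]) hn
        (by
          simp only [Set.mem_insert_iff, Set.mem_singleton_iff, forall_eq_or_imp, forall_eq,
            Sym2.map_mk, SimpleGraph.mem_edgeSet]
          exact ⟨hqx, hcx.symm, hqy, hcy.symm, hqz, hcz.symm, hqp⟩)
        (hG.trans (by rw [hn]; decide))
      exact Or.inl ⟨φ⟩
    · obtain ⟨t, rfl⟩ := Finset.card_eq_one.mp hM1
      obtain ⟨hqt, hct, ht⟩ := hM t (by simp)
      have hn : Fintype.card V = 7 := by omega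
      clear hM hM1 hsplit hE hV
      obtain ⟨φ, hφ⟩ := exists_iso_of_card (K := G.graph) (f := ![q, c, x, y, z, p, t])
        (s := {s(0, 2), s(2, 1), s(0, 3), s(3, 1), s(0, 4), s(4, 1), s(0, 5), s(1, 6)})
        (by simp only [List.ofFn_succ, List.nodup_cons]; simp; grind [SimpleGraph.irrefl]) hn
        (by
          simp only [Set.mem_insert_iff, Set.mem_singleton_iff, forall_eq_or_imp, forall_eq,
            Sym2.map_mk, SimpleGraph.mem_edgeSet]
          exact ⟨hqx, hcx.symm, hqy, hcy.symm, hqz, hcz.symm, hqp, hct⟩)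
        (hG.trans (by rw [hn]; decide))
      exact Or.inr (Or.inl ⟨φ⟩)

open Classical in
-- The edge count gives `q` two neighbours in the 4-cycle: both in `R`, giving `G2`, or one in each
-- part, closing the triangle of `G11`.
theorem IsPendantSplit.isExceptional_of_two_two (h : G.IsPendantSplit p q R S)
    (hbi : G.IsBicyclic) (hR : R.card = 2) (hS : S.card = 2)
    (hle : (S.filter fun i => G.graph.Adj q i).card ≤ (R.filter fun i => G.graph.Adj q i).card) :
    G.IsExceptional := by
  have hE := h.ncard_edgeSet
  have hn := h.card_eq
  have hG := hbi.2.le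
  rw [hbi.2, hn, hR, hS] at hE
  rw [hR, hS] at hn
  have hqp := h.adj.symm
  have hne := h.adj.ne
  have ha := R.card_filter_le fun i => G.graph.Adj q i
  obtain ha | ha : (R.filter fun i => G.graph.Adj q i).card = 2 ∨
    (R.filter fun i => G.graph.Adj q i).card = 1 := by omega
  · have hRq := Finset.filter_eq_self.mp (Finset.eq_of_subset_of_card_le (R.filter_subset _)
      (by rw [ha, hR]))
    obtain ⟨x, y, hxy, rfl⟩ := Finset.card_eq_two.mp hR
    obtain ⟨z, w, hzw, rfl⟩ := Finset.card_eq_two.mp hS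
    have hxR : x ∈ ({x, y} : Finset V) := by simp
    have hyR : y ∈ ({x, y} : Finset V) := by simp
    have hzS : z ∈ ({z, w} : Finset V) := by simp
    have hwS : w ∈ ({z, w} : Finset V) := by simp
    have hqx := hRq _ hxR
    have hqy := hRq _ hyR
    have hx := h.left_ne x hxR
    have hy := h.left_ne y hyR
    have hz := h.right_ne z hzS
    have hw := h.right_ne w hwS
    have hxz := h.complete x hxR z hzS
    have hxw := h.complete x hxR w hwS
    have hyz := h.complete y hyR z hzS
    have hyw := h.complete y hyR w hwS
    have hmin := h.minor x hxR y hyR z hzS w hwS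
    clear ha hle hRq hE h hR hS hbi hxR hyR hzS hwS
    obtain ⟨φ, hφ⟩ := exists_iso_of_card (K := G.graph) (f := ![x, y, z, w, q, p])
      (s := {s(0, 2), s(2, 1), s(0, 3), s(3, 1), s(0, 4), s(4, 1), s(4, 5)})
      (by simp only [List.ofFn_succ, List.nodup_cons]; simp; grind [SimpleGraph.irrefl]) hn
      (by
        simp only [Set.mem_insert_iff, Set.mem_singleton_iff, forall_eq_or_imp, forall_eq,
          Sym2.map_mk, SimpleGraph.mem_edgeSet]
        exact ⟨hxz, hyz.symm, hxw, hyw.symm, hqx.symm, hqy, hqp⟩)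
      (hG.trans (by rw [hn]; decide))
    refine Or.inr (Or.inr (Or.inr (Or.inr (Or.inr (Or.inr (Or.inl ⟨φ, ?_⟩))))))
    change G.adjMatrix (φ 0) (φ 2) * G.adjMatrix (φ 3) (φ 1) =
      G.adjMatrix (φ 2) (φ 1) * G.adjMatrix (φ 0) (φ 3)
    rw [hφ, hφ, hφ, hφ]
    change G.adjMatrix x z * G.adjMatrix w y = G.adjMatrix z y * G.adjMatrix x w
    rw [G.adjMatrix_comm w y, G.adjMatrix_comm z y, hmin, mul_comm]
  · obtain ⟨x, hx1⟩ := Finset.card_eq_one.mp ha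
    obtain ⟨z, hz1⟩ := Finset.card_eq_one.mp
      (show (S.filter fun i => G.graph.Adj q i).card = 1 by omega)
    obtain ⟨hxR, hqx⟩ := Finset.mem_filter.mp (hx1 ▸ Finset.mem_singleton_self x)
    obtain ⟨hzS, hqz⟩ := Finset.mem_filter.mp (hz1 ▸ Finset.mem_singleton_self z)
    obtain ⟨y, hyR, hxy⟩ := Finset.exists_mem_ne (by omega : 1 < R.card) x
    obtain ⟨w, hwS, hzw⟩ := Finset.exists_mem_ne (by omega : 1 < S.card) z
    have hx := h.left_ne x hxR
    have hy := h.left_ne y hyR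
    have hz := h.right_ne z hzS
    have hw := h.right_ne w hwS
    have hxz := h.complete x hxR z hzS
    have hxw := h.complete x hxR w hwS
    have hyz := h.complete y hyR z hzS
    have hyw := h.complete y hyR w hwS
    have hmin := h.minor x hxR y hyR z hzS w hwS
    clear ha hle hx1 hz1 hE h hR hS hbi hxR hyR hzS hwS
    obtain ⟨φ, hφ⟩ := exists_iso_of_card (K := G.graph) (f := ![x, z, w, y, q, p])
      (s := {s(0, 2), s(2, 3), s(3, 1), s(0, 1), s(0, 4), s(4, 1), s(4, 5)})
      (by simp only [List.ofFn_succ, List.nodup_cons]; simp; grind [SimpleGraph.irrefl]) hn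
      (by
        simp only [Set.mem_insert_iff, Set.mem_singleton_iff, forall_eq_or_imp, forall_eq,
          Sym2.map_mk, SimpleGraph.mem_edgeSet]
        exact ⟨hxw, hyw.symm, hyz, hxz, hqx.symm, hqz, hqp⟩)
      (hG.trans (by rw [hn]; decide))
    refine Or.inr (Or.inr (Or.inr (Or.inr (Or.inr (Or.inr (Or.inr ⟨φ, ?_⟩))))))
    change G.adjMatrix (φ 0) (φ 2) * G.adjMatrix (φ 3) (φ 1) =
      G.adjMatrix (φ 2) (φ 3) * G.adjMatrix (φ 0) (φ 1)
    rw [hφ, hφ, hφ, hφ]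
    change G.adjMatrix x w * G.adjMatrix y z = G.adjMatrix w y * G.adjMatrix x z
    rw [G.adjMatrix_comm w y, ← hmin, mul_comm]

open Classical in
-- The remainder is already θ(1,1,1), and `q` has a single neighbour in it: a branch vertex (`G4`)
-- or an inner vertex (`G5`).
theorem IsPendantSplit.isExceptional_of_two_three (h : G.IsPendantSplit p q R S)
    (hbi : G.IsBicyclic) (hR : R.card = 2) (hS : S.card = 3) :
    G.IsExceptional := by
  have hE := h.ncard_edgeSet
  have hn := h.card_eq
  have hG := hbi.2.le
  rw [hbi.2, hn, hR, hS] at hE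
  rw [hR, hS] at hn
  have hqp := h.adj.symm
  have hne := h.adj.ne
  obtain ha | hb : (R.filter fun i => G.graph.Adj q i).card = 1 ∨
    (S.filter fun i => G.graph.Adj q i).card = 1 := by omega
  · obtain ⟨x, hx1⟩ := Finset.card_eq_one.mp ha
    obtain ⟨hxR, hqx⟩ := Finset.mem_filter.mp (hx1 ▸ Finset.mem_singleton_self x)
    obtain ⟨y, hyR, hxy⟩ := Finset.exists_mem_ne (by omega : 1 < R.card) x
    obtain ⟨z, w, t, hzw, hzt, hwt, rfl⟩ := Finset.card_eq_three.mp hS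
    have hzS : z ∈ ({z, w, t} : Finset V) := by simp
    have hwS : w ∈ ({z, w, t} : Finset V) := by simp
    have htS : t ∈ ({z, w, t} : Finset V) := by simp
    have hx := h.left_ne x hxR
    have hy := h.left_ne y hyR
    have hz := h.right_ne z hzS
    have hw := h.right_ne w hwS
    have ht := h.right_ne t htS
    have hxz := h.complete x hxR z hzS
    have hxw := h.complete x hxR w hwS
    have hxt := h.complete x hxR t htS
    have hyz := h.complete y hyR z hzS
    have hyw := h.complete y hyR w hwS
    have hyt := h.complete y hyR t htS
    have hmin := h.minor x hxR y hyR z hzS w hwS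
    have hmin' := h.minor x hxR y hyR z hzS t htS
    clear ha hx1 hE h hR hS hbi hxR hyR hzS hwS htS
    obtain ⟨φ, hφ⟩ := exists_iso_of_card (K := G.graph) (f := ![x, y, z, w, t, q, p])
      (s := {s(0, 2), s(2, 1), s(0, 3), s(3, 1), s(0, 4), s(4, 1), s(0, 5), s(5, 6)})
      (by simp only [List.ofFn_succ, List.nodup_cons]; simp; grind [SimpleGraph.irrefl]) hn
      (by
        simp only [Set.mem_insert_iff, Set.mem_singleton_iff, forall_eq_or_imp, forall_eq,
          Sym2.map_mk, SimpleGraph.mem_edgeSet]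
        exact ⟨hxz, hyz.symm, hxw, hyw.symm, hxt, hyt.symm, hqx.symm, hqp⟩)
      (hG.trans (by rw [hn]; decide))
    refine Or.inr (Or.inr (Or.inr (Or.inr (Or.inl ⟨φ, ?_, ?_⟩))))
    · change G.adjMatrix (φ 2) (φ 1) * G.adjMatrix (φ 0) (φ 3) =
        G.adjMatrix (φ 0) (φ 2) * G.adjMatrix (φ 3) (φ 1)
      rw [hφ, hφ, hφ, hφ]
      change G.adjMatrix z y * G.adjMatrix x w = G.adjMatrix x z * G.adjMatrix w y
      rw [G.adjMatrix_comm z y, G.adjMatrix_comm w y, hmin, mul_comm]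
    · change G.adjMatrix (φ 2) (φ 1) * G.adjMatrix (φ 0) (φ 4) =
        G.adjMatrix (φ 0) (φ 2) * G.adjMatrix (φ 4) (φ 1)
      rw [hφ, hφ, hφ, hφ]
      change G.adjMatrix z y * G.adjMatrix x t = G.adjMatrix x z * G.adjMatrix t y
      rw [G.adjMatrix_comm z y, G.adjMatrix_comm t y, hmin', mul_comm]
  · obtain ⟨t, ht1⟩ := Finset.card_eq_one.mp hb
    obtain ⟨htS, hqt⟩ := Finset.mem_filter.mp (ht1 ▸ Finset.mem_singleton_self t)
    obtain ⟨x, y, hxy, rfl⟩ := Finset.card_eq_two.mp hR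
    obtain ⟨z, w, hzw, hzw'⟩ := Finset.card_eq_two.mp
      (show (S.erase t).card = 2 by rw [Finset.card_erase_of_mem htS, hS])
    obtain ⟨hzt, hzS⟩ := Finset.mem_erase.mp (show z ∈ S.erase t by simp [hzw'])
    obtain ⟨hwt, hwS⟩ := Finset.mem_erase.mp (show w ∈ S.erase t by simp [hzw'])
    have hxR : x ∈ ({x, y} : Finset V) := by simp
    have hyR : y ∈ ({x, y} : Finset V) := by simp
    have hx := h.left_ne x hxR
    have hy := h.left_ne y hyR
    have hz := h.right_ne z hzS
    have hw := h.right_ne w hwS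
    have ht := h.right_ne t htS
    have hxz := h.complete x hxR z hzS
    have hxw := h.complete x hxR w hwS
    have hxt := h.complete x hxR t htS
    have hyz := h.complete y hyR z hzS
    have hyw := h.complete y hyR w hwS
    have hyt := h.complete y hyR t htS
    have hmin := h.minor x hxR y hyR z hzS w hwS
    have hmin' := h.minor x hxR y hyR z hzS t htS
    clear hb ht1 hzw' hE h hR hS hbi hxR hyR hzS hwS htS
    obtain ⟨φ, hφ⟩ := exists_iso_of_card (K := G.graph) (f := ![x, y, z, w, t, q, p])
      (s := {s(0, 2), s(2, 1), s(0, 3), s(3, 1), s(0, 4), s(4, 1), s(4, 5), s(5, 6)})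
      (by simp only [List.ofFn_succ, List.nodup_cons]; simp; grind [SimpleGraph.irrefl]) hn
      (by
        simp only [Set.mem_insert_iff, Set.mem_singleton_iff, forall_eq_or_imp, forall_eq,
          Sym2.map_mk, SimpleGraph.mem_edgeSet]
        exact ⟨hxz, hyz.symm, hxw, hyw.symm, hxt, hyt.symm, hqt.symm, hqp⟩)
      (hG.trans (by rw [hn]; decide))
    refine Or.inr (Or.inr (Or.inr (Or.inr (Or.inr (Or.inl ⟨φ, ?_, ?_⟩)))))
    · change G.adjMatrix (φ 2) (φ 1) * G.adjMatrix (φ 0) (φ 3) =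
        G.adjMatrix (φ 0) (φ 2) * G.adjMatrix (φ 3) (φ 1)
      rw [hφ, hφ, hφ, hφ]
      change G.adjMatrix z y * G.adjMatrix x w = G.adjMatrix x z * G.adjMatrix w y
      rw [G.adjMatrix_comm z y, G.adjMatrix_comm w y, hmin, mul_comm]
    · change G.adjMatrix (φ 2) (φ 1) * G.adjMatrix (φ 0) (φ 4) =
        G.adjMatrix (φ 0) (φ 2) * G.adjMatrix (φ 4) (φ 1)
      rw [hφ, hφ, hφ, hφ]
      change G.adjMatrix z y * G.adjMatrix x t = G.adjMatrix x z * G.adjMatrix t y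
      rw [G.adjMatrix_comm z y, G.adjMatrix_comm t y, hmin', mul_comm]

open Classical in
theorem IsPendantSplit.card_le_two (h : G.IsPendantSplit p q R S) (hbi : G.IsBicyclic)
    (hle : R.card ≤ S.card) : R.card = 1 ∨ R.card = 2 ∧ S.card = 2 ∨ R.card = 2 ∧ S.card = 3 := by
  have hE := h.ncard_edgeSet
  rw [hbi.2, h.card_eq] at hE
  -- Otherwise `p` and `q` form a whole component.
  have hpos : 1 ≤ (R.filter fun i => G.graph.Adj q i).card +
      (S.filter fun i => G.graph.Adj q i).card := by
    by_contra! h0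
    have h0R : R.filter (fun i => G.graph.Adj q i) = ∅ := Finset.card_eq_zero.mp (by omega)
    have h0S : S.filter (fun i => G.graph.Adj q i) = ∅ := Finset.card_eq_zero.mp (by omega)
    rw [Finset.filter_eq_empty_iff] at h0R h0S
    have hreach : ∀ v, v = p ∨ v = q := fun v => by
      have hv := (SimpleGraph.reachable_iff_reflTransGen p v).mp (hbi.1.preconnected p v)
      induction hv with
      | refl => exact Or.inl rfl
      | @tail u v _ huv ih =>
        rcases ih with rfl | rfl
        · exact Or.inr (h.pendant v huv)
        · rcases h.cover v with hv | hv | hv | hv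
          exacts [Or.inl hv, Or.inr hv, absurd huv (h0R hv), absurd huv (h0S hv)]
    have hR : R = ∅ := Finset.eq_empty_of_forall_notMem fun v hv => by
      have := hreach v; have := h.left_ne v hv; tauto
    have hS : S = ∅ := Finset.eq_empty_of_forall_notMem fun v hv => by
      have := hreach v; have := h.right_ne v hv; tauto
    simp [hR, hS] at hE
  have ha := R.card_filter_le fun i => G.graph.Adj q i
  have hb := S.card_filter_le fun i => G.graph.Adj q i
  generalize (R.filter fun i => G.graph.Adj q i).card = a at *
  generalize (S.filter fun i => G.graph.Adj q i).card = b at *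
  generalize R.card = r at *
  generalize S.card = s at *
  have h3 : r < 3 := by
    by_contra! h3
    nlinarith
  -- The value `r = 0` dies because it would force `b = s + 2`, while `b ≤ s`.
  interval_cases r <;> omega

end WeightedGraph
end WBicyclic

/-! ### The main theorem -/

open WBicyclic WeightedGraph in
theorem theorem4p6 {V : Type*} [Fintype V] (G : WBicyclic.WeightedGraph V)
    (hbi : G.IsBicyclic) (hpend : ∃ v : V, G.IsPendant v)
    (htwin : ¬ ∃ u v : V, G.IsPendantTwin u v) :
    G.negIndex = 2 ↔
      Nonempty (WBicyclic.G1 ≃g G.graph) ∨ Nonempty (WBicyclic.G3 ≃g G.graph) ∨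
      Nonempty (WBicyclic.G6 ≃g G.graph) ∨ Nonempty (WBicyclic.G8 ≃g G.graph) ∨
      G.IsG4 ∨ G.IsG5 ∨ G.IsG2 ∨ G.IsG11 := by
  classical
  constructor
  · intro hneg
    obtain ⟨p, q, R, S, h⟩ := exists_isPendantSplit hbi hpend htwin hneg.le
    -- Breaking ties by the number of neighbours of `q` leaves only the distributions 2 + 0 and 1 +
    -- 1 when both parts have size two.
    wlog hle : R.card < S.card ∨ R.card = S.card ∧ (S.filter fun i => G.graph.Adj q i).card ≤
        (R.filter fun i => G.graph.Adj q i).card generalizing R S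
    · exact this S R h.symm (by omega)
    rcases h.card_le_two hbi (by omega) with hR | ⟨hR, hS⟩ | ⟨hR, hS⟩
    · exact h.isExceptional_of_star hbi htwin hR
    · exact h.isExceptional_of_two_two hbi hR hS (by omega)
    · exact h.isExceptional_of_two_three hbi hR hS
  · rintro (⟨⟨φ⟩⟩ | ⟨⟨φ⟩⟩ | ⟨⟨φ⟩⟩ | ⟨⟨φ⟩⟩ | ⟨φ, h, h'⟩ | ⟨φ, h, h'⟩ | ⟨φ, h⟩ | ⟨φ, h⟩)
    exacts [G.negIndex_of_G1 φ, G.negIndex_of_G3 φ, G.negIndex_of_G6 φ, G.negIndex_of_G8 φ,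
      G.negIndex_of_G4 φ h h', G.negIndex_of_G5 φ h h', G.negIndex_of_G2 φ h,
      G.negIndex_of_G11 φ h]
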